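/- Fix a set $\mathsf A$ of atomic formulae containing $\top,\bot$; formulas are built from $\mathsf A$ by $\wedge,\neg,\mathsf K,\Box$, and the complexity $c(\phi)$ of a formula $\phi$ is its number of occurrences of connectives and modalities. A \emph{model} $\mathcal M=\langle X,\mathcal O,i\rangle$ consists of a set $X$, a family $\mathcal O\subseteq\mathcal P(X)$ with $X\in\mathcal O$, and a map $i:\mathsf A\to\mathcal P(X)$ with $i(\top)=X$, $i(\bot)=\emptyset$; it is \emph{topological} if $\mathcal O$ is a topology on $X$. For $x\in U\in\mathcal O$, satisfaction is defined by: $x,U\models A$ iff $x\in i(A)$ (for $A\in\mathsf A$); $\wedge$ and $\neg$ are Boolean; $x,U\models\mathsf K\phi$ iff $y,U\models\phi$ for all $y\in U$; $x,U\models\Box\phi$ iff $x,V\models\phi$ for all $V\in\mathcal O$ with $x\in V\subseteq U$. The formula $\phi$ is satisfied in $\mathcal M$ if $x,U\models\phi$ for some $x\in U\in\mathcal O$. For a family $\mathcal F\subseteq\mathcal O$ and $U\in\mathcal F$, the remainder $\mathrm{Rem}^{\mathcal F}U$ is the set of all $V\in\mathcal O$ with $V\subseteq U$ such that $V\not\subseteq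 W$ for every $W\in\mathcal F$ with $U\not\subseteq W$. A finite $\mathcal F\subseteq\mathcal O$ closed under binary intersections is called a \emph{stable splitting for $\psi$} if for every $U\in\mathcal F$ and every point $x$, either $x,V\models\psi$ for all $V\in\mathrm{Rem}^{\mathcal F}U$ with $x\in V$, or $x,V\models\neg\psi$ for all such $V$. When $X\in\mathcal F$, the sets $\mathrm{Rem}^{\mathcal F}U$ ($U\in\mathcal F$) partition $\mathcal O$, and $U$ is the largest member of $\mathrm{Rem}^{\mathcal F}U$. Given $\mathcal F$ with $X\in\mathcal F$ and a formula $\phi$, let $x\sim y$ iff $x,y$ belong to the same members of $\mathcal F$ and to the same sets $i(A)$, $A$ an atomic formula occurring in $\phi$; write $x^*$ for the class of $x$, $S^*=\{x^*:x\in S\}$ for $S\subseteq X$, and let $\mathcal M/(\mathcal F,\phi)$ be the model $\langle X^*,\{U^*:U\in\mathcal F\},i^*\rangle$ with $i^*(A)=i(A)^*$. \textbf{Theorem.} There is a computable function $f:\mathbb N\to\mathbb N$ such that for every topological model $\mathcal M=\langle X,\mathcal T,i\rangle$ and every formula $\phi$ satisfied in $\mathcal M$ there is a family $\mathcal F\subseteq\mathcal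 T$ with $X\in\mathcal F$ which is a finite stable splitting for every subformula of $\phi$ (including $\phi$) and such that $\mathcal M^*=\mathcal M/(\mathcal F,\phi)$ is a finite topological model in which $\phi$ is satisfied; moreover the number of members of $\mathcal F$, the number of points of $\mathcal M^*$ and the number of open sets of $\mathcal M^*$ are all at most $f(c(\phi))$, and for every subformula $\psi$ of $\phi$, all $U\in\mathcal F$, $V\in\mathrm{Rem}^{\mathcal F}U$ and $x\in V$, $$x,V\models_{\mathcal M}\psi\iff x^*,U^*\models_{\mathcal M^*}\psi .$$ -/

import Mathlib

namespace TopoLogic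

/-- Formulas of the bimodal language over the atomic formulae `α`, together with the two
distinguished atomic formulae `⊤` and `⊥`. -/
inductive Formula (α : Type*) where
  | atom (a : α) : Formula α
  | top : Formula α
  | bot : Formula α
  | and (φ ψ : Formula α) : Formula α
  | neg (φ : Formula α) : Formula α
  | know (φ : Formula α) : Formula α
  | box (φ : Formula α) : Formula α

namespace Formula

variable {α : Type*}

/-- The number of occurrences of connectives and modalities. -/
def complexity : Formula α → ℕ
  | atom _ => 0
  | top => 0
  | bot => 0
  | and φ ψ => φ.complexity + ψ.complexity + 1
  | neg φ => φ.complexity + 1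
  | know φ => φ.complexity + 1
  | box φ => φ.complexity + 1

/-- The atomic formulae (other than `⊤` and `⊥`) that occur in a formula. -/
def atoms : Formula α → Set α
  | atom a => {a}
  | top => ∅
  | bot => ∅
  | and φ ψ => φ.atoms ∪ ψ.atoms
  | neg φ => φ.atoms
  | know φ => φ.atoms
  | box φ => φ.atoms

/-- The subformulas of a formula, including the formula itself. -/
def subformulas : Formula α → Set (Formula α)
  | atom a => {atom a}
  | top => {top}
  | bot => {bot}
  | and φ ψ => {and φ ψ} ∪ (φ.subformulas ∪ ψ.subformulas)
  | neg φ => {neg φ} ∪ φ.subformulas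
  | know φ => {know φ} ∪ φ.subformulas
  | box φ => {box φ} ∪ φ.subformulas

end Formula

/-- A model: a subset space `(X, opens)` with `X ∈ opens`, and an initial interpretation of the
atomic formulae. The interpretations of `⊤` and `⊥` are fixed to be `X` and `∅` in `Model.Sat`. -/
structure Model (α : Type*) (X : Type*) where
  opens : Set (Set X)
  univ_mem : Set.univ ∈ opens
  val : α → Set X

namespace Model

variable {α X : Type*}

/-- The model is topological: its family of subsets is the family of open sets of a topology. -/
def IsTopological (M : Model α X) : Prop :=
  ∃ t : TopologicalSpace X, ∀ U : Set X, U ∈ M.opens ↔ @IsOpen X t U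

/-- The satisfaction relation `x, U ⊨ φ`; it is meaningful for `x ∈ U ∈ M.opens`. -/
def Sat (M : Model α X) : Formula α → X → Set X → Prop
  | .atom a, x, _ => x ∈ M.val a
  | .top, _, _ => True
  | .bot, _, _ => False
  | .and φ ψ, x, U => M.Sat φ x U ∧ M.Sat ψ x U
  | .neg φ, x, U => ¬ M.Sat φ x U
  | .know φ, _, U => ∀ y ∈ U, M.Sat φ y U
  | .box φ, x, U => ∀ V ∈ M.opens, V ⊆ U → x ∈ V → M.Sat φ x V

/-- `φ` is satisfied in the model: `x, U ⊨ φ` for some `x ∈ U ∈ M.opens`. -/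
def Satisfies (M : Model α X) (φ : Formula α) : Prop :=
  ∃ U ∈ M.opens, ∃ x ∈ U, M.Sat φ x U

/-- The remainder of `U` in the family `F`: the members of `opens` that are contained in `U` but
in no member of `F` that does not contain `U`. -/
def remainder (M : Model α X) (F : Set (Set X)) (U : Set X) : Set (Set X) :=
  {V | V ∈ M.opens ∧ V ⊆ U ∧ ∀ W ∈ F, ¬ U ⊆ W → ¬ V ⊆ W}

/-- A finite splitting: a finite family of members of `opens` closed under intersection (its
remainders partition the members of `opens` that are contained in a member of the family). -/
def IsFiniteSplitting (M : Model α X) (F : Set (Set X)) : Prop :=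
  F.Finite ∧ F ⊆ M.opens ∧ ∀ U ∈ F, ∀ V ∈ F, U ∩ V ∈ F

/-- A set `G` of opens is stable for `φ` if `φ` keeps its truth value at each point throughout
`G`. -/
def IsStable (M : Model α X) (G : Set (Set X)) (φ : Formula α) : Prop :=
  ∀ x : X, (∀ V ∈ G, x ∈ V → M.Sat φ x V) ∨ (∀ V ∈ G, x ∈ V → M.Sat φ.neg x V)

/-- A finite splitting all of whose remainders are stable for `φ`. -/
def IsStableSplitting (M : Model α X) (F : Set (Set X)) (φ : Formula α) : Prop :=
  M.IsFiniteSplitting F ∧ ∀ U ∈ F, M.IsStable (M.remainder F U) φ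

/-- Indistinguishability of points: `x ∼ y` if `x` and `y` belong to the same members of `F` and
to the interpretations of the same atomic formulae occurring in `φ`. -/
def indist (M : Model α X) (F : Set (Set X)) (φ : Formula α) : Setoid X where
  r x y := (∀ U ∈ F, x ∈ U ↔ y ∈ U) ∧ ∀ a ∈ φ.atoms, x ∈ M.val a ↔ y ∈ M.val a
  iseqv :=
    { refl := fun _ => ⟨fun _ _ => Iff.rfl, fun _ _ => Iff.rfl⟩
      symm := fun h => ⟨fun U hU => (h.1 U hU).symm, fun a ha => (h.2 a ha).symm⟩
      trans := fun h k =>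
        ⟨fun U hU => (h.1 U hU).trans (k.1 U hU), fun a ha => (h.2 a ha).trans (k.2 a ha)⟩ }

/-- The points of the quotient model. -/
abbrev QuotPoint (M : Model α X) (F : Set (Set X)) (φ : Formula α) :=
  Quotient (M.indist F φ)

/-- The class `x*` of a point. -/
def cls (M : Model α X) (F : Set (Set X)) (φ : Formula α) (x : X) : M.QuotPoint F φ :=
  Quotient.mk (M.indist F φ) x

/-- The quotient of the model by the splitting `F` on opens and by indistinguishability on points.
The equivalence classes of opens are the remainders of the members of `F`; the class
`remainder F U` is represented by its largest element `U`, and gives the open set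
`U* = {x* | x ∈ U}` of the quotient. Likewise `i*(A) = {x* | x ∈ i(A)}`. -/
def quotient (M : Model α X) (F : Set (Set X)) (hF : Set.univ ∈ F) (φ : Formula α) :
    Model α (M.QuotPoint F φ) where
  opens := {W | ∃ U ∈ F, W = M.cls F φ '' U}
  univ_mem := ⟨Set.univ, hF, by
    rw [Set.image_univ]
    exact (Set.range_eq_univ.2 Quotient.mk_surjective).symm⟩
  val a := M.cls F φ '' M.val a

end Model

end TopoLogic

namespace TopoLogic

open Set

/-! ### Subformulas and atomic formulae. -/

namespace Formula

variable {α : Type*}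

/-! Stability is replaced by `Separates`, which survives enlarging the family. By induction on `φ`,
`exists_separates` builds a finite lattice `F` of open sets separating all subformulas. For `K φ`
one adds the interiors of the truth sets of `φ` at members of `F` (`Separates.know`); for `□ φ`, the
Heyting implications `interior (Uᶜ ∪ W)` (`Separates.box`). Each time a lattice is generated anew,
of at most doubly exponential size. Since `F` is a finite lattice, every open set has a hull in `F`
and lies in the remainder of that hull, and the images of members of `F` form a topology on the
quotient. Truth is transferred by `sat_quotient_iff`. -/

theorem self_mem_subformulas (φ : Formula α) : φ ∈ φ.subformulas := by
  cases φ <;> simp [subformulas]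

theorem atoms_subset_of_mem_subformulas {φ ψ : Formula α} (h : ψ ∈ φ.subformulas) :
    ψ.atoms ⊆ φ.atoms := by
  induction φ with
  | atom a => simp_all [subformulas]
  | top => simp_all [subformulas]
  | bot => simp_all [subformulas]
  | and φ₁ φ₂ ih₁ ih₂ =>
    rcases h with rfl | h | h
    · rfl
    · exact (ih₁ h).trans subset_union_left
    · exact (ih₂ h).trans subset_union_right
  | neg φ ih | know φ ih | box φ ih =>
    rcases h with rfl | h
    · rfl
    · exact ih h

theorem subformulas_subset {φ ψ : Formula α} (h : ψ ∈ φ.subformulas) :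
    ψ.subformulas ⊆ φ.subformulas := by
  induction φ with
  | atom a | top | bot =>
    rw [show ψ = _ from h]
  | and φ₁ φ₂ ih₁ ih₂ =>
    rcases h with rfl | h | h
    · rfl
    · exact (ih₁ h).trans fun _ hχ => .inr (.inl hχ)
    · exact (ih₂ h).trans fun _ hχ => .inr (.inr hχ)
  | neg φ ih | know φ ih | box φ ih =>
    rcases h with rfl | h
    · rfl
    · exact (ih h).trans fun _ hχ => .inr hχ

theorem finite_atoms (φ : Formula α) : φ.atoms.Finite := by
  induction φ with
  | atom a => exact finite_singleton a
  | top => exact finite_empty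
  | bot => exact finite_empty
  | and φ₁ φ₂ ih₁ ih₂ => exact ih₁.union ih₂
  | neg φ ih | know φ ih | box φ ih => exact ih

theorem ncard_atoms_le (φ : Formula α) : φ.atoms.ncard ≤ φ.complexity + 1 := by
  induction φ with
  | atom a => simp [atoms]
  | top => simp [atoms]
  | bot => simp [atoms]
  | and φ₁ φ₂ ih₁ ih₂ =>
    have := ncard_union_le φ₁.atoms φ₂.atoms
    simp only [atoms, complexity]
    omega
  | neg φ ih | know φ ih | box φ ih =>
    simp only [atoms, complexity]
    omega

end Formula

/-! ### Finite lattices of sets. -/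

/-- A family of sets that contains the empty set and the whole space and is closed under binary
intersections and unions. -/
structure IsSetLattice {X : Type*} (F : Set (Set X)) : Prop where
  univ_mem : univ ∈ F
  empty_mem : ∅ ∈ F
  inter_mem : ∀ U ∈ F, ∀ V ∈ F, U ∩ V ∈ F
  union_mem : ∀ U ∈ F, ∀ V ∈ F, U ∪ V ∈ F

namespace IsSetLattice

variable {X : Type*} {F : Set (Set X)}

theorem sInter_mem (hF : IsSetLattice F) (hfin : F.Finite) {A : Set (Set X)} (hA : A ⊆ F) :
    ⋂₀ A ∈ F := by
  induction A, hfin.subset hA using Set.Finite.induction_on with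
  | empty => simpa using hF.univ_mem
  | insert _ _ ih =>
    rw [sInter_insert]
    exact hF.inter_mem _ (hA (mem_insert _ _)) _ (ih ((subset_insert _ _).trans hA))

theorem sUnion_mem (hF : IsSetLattice F) (hfin : F.Finite) {A : Set (Set X)} (hA : A ⊆ F) :
    ⋃₀ A ∈ F := by
  induction A, hfin.subset hA using Set.Finite.induction_on with
  | empty => simpa using hF.empty_mem
  | insert _ _ ih =>
    rw [sUnion_insert]
    exact hF.union_mem _ (hA (mem_insert _ _)) _ (ih ((subset_insert _ _).trans hA))

/-- Every set has a smallest superset in a finite lattice of sets. -/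
theorem exists_hull (hF : IsSetLattice F) (hfin : F.Finite) (V : Set X) :
    ∃ U ∈ F, V ⊆ U ∧ ∀ W ∈ F, V ⊆ W → U ⊆ W :=
  ⟨⋂₀ {W ∈ F | V ⊆ W}, hF.sInter_mem hfin (sep_subset _ _), subset_sInter fun _ h => h.2,
    fun _ hW h => sInter_subset_of_mem ⟨hW, h⟩⟩

end IsSetLattice

/-- A finite family of open sets is contained in a lattice of open sets of doubly exponential
size. -/
theorem exists_isSetLattice_of_finite {X : Type*} [TopologicalSpace X] {S : Set (Set X)}
    (hS : S.Finite) (hopen : ∀ U ∈ S, IsOpen U) :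
    ∃ F : Set (Set X), S ⊆ F ∧ F.Finite ∧ (∀ U ∈ F, IsOpen U) ∧ IsSetLattice F ∧
      F.ncard ≤ 2 ^ 2 ^ S.ncard := by
  have : Finite S := hS
  -- The lattice consists of the monotone Boolean combinations of `S`: preimages of upper sets under
  -- the map sending a point to the members of `S` containing it.
  let sig : X → Set S := fun x => {s | x ∈ s.1}
  let g : Set (Set S) → Set X := fun A => sig ⁻¹' A
  have hfin : {A : Set (Set S) | IsUpperSet A}.Finite := toFinite _
  refine ⟨g '' {A | IsUpperSet A}, fun s hs => ?_, hfin.image g, ?_, ⟨?_, ?_, ?_, ?_⟩, ?_⟩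
  · exact ⟨{a | ⟨s, hs⟩ ∈ a}, fun a b hab ha => hab ha, rfl⟩
  · rintro _ ⟨A, hA, rfl⟩
    have : g A = ⋃ a ∈ A, ⋂ s ∈ a, (s : Set X) := by
      ext x
      simp only [g, mem_preimage, mem_iUnion, mem_iInter, exists_prop]
      exact ⟨fun h => ⟨sig x, h, fun _ hs => hs⟩, fun ⟨a, ha, h⟩ => hA (fun s hs => h s hs) ha⟩
    rw [this]
    exact isOpen_biUnion fun a _ => (toFinite a).isOpen_biInter fun s _ => hopen s s.2
  · exact ⟨univ, isUpperSet_univ, rfl⟩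
  · exact ⟨∅, isUpperSet_empty, rfl⟩
  · rintro _ ⟨A, hA, rfl⟩ _ ⟨B, hB, rfl⟩
    exact ⟨A ∩ B, hA.inter hB, rfl⟩
  · rintro _ ⟨A, hA, rfl⟩ _ ⟨B, hB, rfl⟩
    exact ⟨A ∪ B, hA.union hB, rfl⟩
  · calc _ ≤ {A : Set (Set S) | IsUpperSet A}.ncard := ncard_image_le hfin
      _ ≤ (univ : Set (Set (Set S))).ncard := ncard_le_ncard (subset_univ _)
      _ = 2 ^ 2 ^ S.ncard := by
        have := Fintype.ofFinite S
        rw [ncard_univ, Nat.card_eq_fintype_card, Fintype.card_set, Fintype.card_set,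
          ← Nat.card_eq_fintype_card, Nat.card_coe_set_eq]

/-! ### Computable size bounds. -/

/-- A bound for the size of the splitting of a formula, by complexity. -/
def splittingBound : ℕ → ℕ
  | 0 => 2
  -- With `b` the previous bound, `∧` and `K` need at most `2 * b` generators and `□` at most `b + b
  -- * b`; the exponent covers all cases.
  | n + 1 => 2 ^ 2 ^ (2 * splittingBound n + splittingBound n * splittingBound n)

/-- A bound for the size of the quotient model of a formula, by complexity. -/
def modelBound (n : ℕ) : ℕ :=
  2 ^ splittingBound n * 2 ^ (n + 1)

theorem splittingBound_mono : Monotone splittingBound := by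
  refine monotone_nat_of_le_succ fun n => ?_
  have h₁ := (Nat.lt_two_pow_self (n := 2 * splittingBound n + splittingBound n * splittingBound n))
  have h₂ := (Nat.lt_two_pow_self
    (n := 2 ^ (2 * splittingBound n + splittingBound n * splittingBound n)))
  rw [splittingBound]
  omega

theorem splittingBound_le_modelBound (n : ℕ) : splittingBound n ≤ modelBound n :=
  Nat.lt_two_pow_self.le.trans (Nat.le_mul_of_pos_right _ (by positivity))

theorem computable_modelBound : Computable modelBound := by
  have hpow : Primrec₂ ((· ^ ·) : ℕ → ℕ → ℕ) := Primrec₂.unpaired'.1 Nat.Primrec.pow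
  have htwo : ∀ {g : ℕ → ℕ}, Primrec g → Primrec fun n => 2 ^ g n :=
    fun h => hpow.comp (Primrec.const 2) h
  have hb : Primrec splittingBound := by
    have hstep : Primrec fun b : ℕ => 2 ^ 2 ^ (2 * b + b * b) :=
      htwo (htwo (Primrec.nat_add.comp (Primrec.nat_mul.comp (Primrec.const 2) Primrec.id)
        (Primrec.nat_mul.comp Primrec.id Primrec.id)))
    refine (Primrec.nat_rec₁ 2 (hstep.comp Primrec.snd).to₂).of_eq fun n => ?_
    induction n with
    | zero => rfl
    | succ n ih => rw [splittingBound, ← ih]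
  exact (Primrec.nat_mul.comp (htwo hb) (htwo Primrec.succ)).to_comp

/-! ### Separating families. -/

namespace Model

variable {α X : Type*}

/-- At each point, the truth value of `φ` on open sets depends only on which members of `F`
contain them. -/
def Separates (M : Model α X) (F : Set (Set X)) (φ : Formula α) : Prop :=
  ∀ V ∈ M.opens, ∀ V' ∈ M.opens, (∀ W ∈ F, V ⊆ W ↔ V' ⊆ W) →
    ∀ x ∈ V, x ∈ V' → (M.Sat φ x V ↔ M.Sat φ x V')

variable {M : Model α X} {F G : Set (Set X)} {φ ψ : Formula α}

theorem Separates.mono (h : M.Separates F φ) (hFG : F ⊆ G) : M.Separates G φ :=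
  fun V hV V' hV' hVV' => h V hV V' hV' fun W hW => hVV' W (hFG hW)

theorem Separates.and (h₁ : M.Separates F φ) (h₂ : M.Separates F ψ) :
    M.Separates F (.and φ ψ) :=
  fun V hV V' hV' hVV' x hx hx' =>
    and_congr (h₁ V hV V' hV' hVV' x hx hx') (h₂ V hV V' hV' hVV' x hx hx')

theorem Separates.neg (h : M.Separates F φ) : M.Separates F (.neg φ) :=
  fun V hV V' hV' hVV' x hx hx' => not_congr (h V hV V' hV' hVV' x hx hx')

section Topological

variable [TopologicalSpace X]

/-- If `U` is the hull of `V` in `F`, then `φ` has the same truth values at points of `V` relative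
to `V` and to `U`. So `K φ` holds at `V` exactly when `V` lies in the interior of the truth set of
`φ` at `U`, a member of `G`. -/
theorem Separates.know (hM : ∀ U, U ∈ M.opens ↔ IsOpen U) (h : M.Separates F φ)
    (hfin : F.Finite) (hF : IsSetLattice F) (hopen : F ⊆ M.opens) (hFG : F ⊆ G)
    (hG : ∀ U ∈ F, interior {x ∈ U | M.Sat φ x U} ∈ G) : M.Separates G (.know φ) := by
  suffices key : ∀ V ∈ M.opens, ∀ V' ∈ M.opens, (∀ W ∈ G, V ⊆ W ↔ V' ⊆ W) →
      (∀ y ∈ V, M.Sat φ y V) → ∀ y ∈ V', M.Sat φ y V' from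
    fun V hV V' hV' hVV' _ _ _ =>
      ⟨key V hV V' hV' hVV', key V' hV' V hV fun W hW => (hVV' W hW).symm⟩
  intro V hV V' hV' hVV' hsat y hy
  obtain ⟨U, hU, hVU, hmin⟩ := hF.exists_hull hfin V
  have heq : ∀ W ∈ F, V ⊆ W ↔ U ⊆ W := fun W hW => ⟨hmin W hW, hVU.trans⟩
  have hsub : V ⊆ interior {x ∈ U | M.Sat φ x U} :=
    interior_maximal (fun z hz => ⟨hVU hz,
      (h V hV U (hopen hU) heq z hz (hVU hz)).1 (hsat z hz)⟩) ((hM V).1 hV)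
  have hy' := interior_subset ((hVV' _ (hG U hU)).1 hsub hy)
  exact (h U (hopen hU) V' hV' (fun W hW => (heq W hW).symm.trans (hVV' W (hFG hW))) y
    hy'.1 hy).1 hy'.2

/-- A neighbourhood `V₁ ⊆ V'` with hull `U` is matched by `V ∩ U ⊆ V`. These two lie in the same
members of `F`: `V ∩ U ⊆ W` means that `V` is below the Heyting implication `interior (Uᶜ ∪ W)`,
which passes to `V'` and hence to `V₁`. -/
theorem Separates.box (hM : ∀ U, U ∈ M.opens ↔ IsOpen U) (h : M.Separates F φ)
    (hfin : F.Finite) (hF : IsSetLattice F) (hopen : F ⊆ M.opens)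
    (hG : ∀ U ∈ F, ∀ W ∈ F, interior (Uᶜ ∪ W) ∈ G) : M.Separates G (.box φ) := by
  suffices key : ∀ V ∈ M.opens, ∀ V' ∈ M.opens, (∀ W ∈ G, V ⊆ W ↔ V' ⊆ W) → ∀ x ∈ V,
      M.Sat (.box φ) x V → M.Sat (.box φ) x V' from
    fun V hV V' hV' hVV' x hx hx' =>
      ⟨key V hV V' hV' hVV' x hx, key V' hV' V hV (fun W hW => (hVV' W hW).symm) x hx'⟩
  intro V hV V' hV' hVV' x hx hsat V₁ hV₁ hsub hx₁
  obtain ⟨U, hU, hVU, hmin⟩ := hF.exists_hull hfin V₁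
  have hVUo : V ∩ U ∈ M.opens :=
    (hM _).2 (((hM V).1 hV).inter ((hM U).1 (hopen hU)))
  refine (h (V ∩ U) hVUo V₁ hV₁ (fun W hW => ⟨fun hle => ?_, fun hle => ?_⟩) x
    ⟨hx, hVU hx₁⟩ hx₁).1 (hsat _ hVUo inter_subset_left ⟨hx, hVU hx₁⟩)
  · have hVi : V ⊆ interior (Uᶜ ∪ W) := by
      refine interior_maximal (fun y hy => ?_) ((hM V).1 hV)
      by_cases hyU : y ∈ U
      · exact .inr (hle ⟨hy, hyU⟩)
      · exact .inl hyU
    intro y hy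
    exact (interior_subset ((hVV' _ (hG U hU W hW)).1 hVi (hsub hy))).resolve_left
      (not_not.2 (hVU hy))
  · exact inter_subset_right.trans (hmin W hW hle)

theorem exists_separates (hM : ∀ U, U ∈ M.opens ↔ IsOpen U) (φ : Formula α) :
    ∃ F : Set (Set X), F.Finite ∧ F ⊆ M.opens ∧ IsSetLattice F ∧
      F.ncard ≤ splittingBound φ.complexity ∧ ∀ ψ ∈ φ.subformulas, M.Separates F ψ := by
  have extend : ∀ (S : Set (Set X)) (n : ℕ), S.Finite → (∀ U ∈ S, IsOpen U) →
      S.ncard ≤ 2 * splittingBound n + splittingBound n * splittingBound n →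
      ∃ F : Set (Set X), S ⊆ F ∧ F.Finite ∧ F ⊆ M.opens ∧ IsSetLattice F ∧
        F.ncard ≤ splittingBound (n + 1) := by
    intro S n hS hopen hcard
    obtain ⟨F, hSF, hfin, hFo, hF, hFc⟩ := exists_isSetLattice_of_finite hS hopen
    refine ⟨F, hSF, hfin, fun U hU => (hM U).2 (hFo U hU), hF, hFc.trans ?_⟩
    rw [splittingBound]
    gcongr <;> norm_num
  -- No generators give at most `2 ^ 2 ^ 0 = 2` sets.
  have base : ∃ F : Set (Set X), F.Finite ∧ F ⊆ M.opens ∧ IsSetLattice F ∧ F.ncard ≤ 2 := by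
    obtain ⟨F, -, hfin, hFo, hF, hFc⟩ :=
      exists_isSetLattice_of_finite (X := X) finite_empty (by simp)
    exact ⟨F, hfin, fun U hU => (hM U).2 (hFo U hU), hF, by simpa using hFc⟩
  induction φ with
  | atom a | top | bot =>
    obtain ⟨F, hfin, hFo, hF, hFc⟩ := base
    refine ⟨F, hfin, hFo, hF, hFc, ?_⟩
    rintro _ rfl V _ V' _ _ x _ _
    rfl
  | and φ₁ φ₂ ih₁ ih₂ =>
    obtain ⟨F₁, hfin₁, hFo₁, hF₁, hFc₁, hs₁⟩ := ih₁
    obtain ⟨F₂, hfin₂, hFo₂, hF₂, hFc₂, hs₂⟩ := ih₂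
    have hb₁ := splittingBound_mono (Nat.le_add_right φ₁.complexity φ₂.complexity)
    have hb₂ := splittingBound_mono (Nat.le_add_left φ₂.complexity φ₁.complexity)
    obtain ⟨F, hSF, hfin, hFo, hF, hFc⟩ := extend (F₁ ∪ F₂) (φ₁.complexity + φ₂.complexity)
      (hfin₁.union hfin₂)
      (fun U hU => (hM U).1 (union_subset hFo₁ hFo₂ hU))
      ((ncard_union_le _ _).trans (by omega))
    have hs₁' : ∀ ψ ∈ φ₁.subformulas, M.Separates F ψ :=
      fun ψ hψ => (hs₁ ψ hψ).mono (subset_union_left.trans hSF)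
    have hs₂' : ∀ ψ ∈ φ₂.subformulas, M.Separates F ψ :=
      fun ψ hψ => (hs₂ ψ hψ).mono (subset_union_right.trans hSF)
    refine ⟨F, hfin, hFo, hF, hFc, ?_⟩
    rintro ψ (rfl | hψ | hψ)
    · exact (hs₁' _ φ₁.self_mem_subformulas).and (hs₂' _ φ₂.self_mem_subformulas)
    · exact hs₁' ψ hψ
    · exact hs₂' ψ hψ
  | neg φ ih =>
    obtain ⟨F, hfin, hFo, hF, hFc, hs⟩ := ih
    refine ⟨F, hfin, hFo, hF, hFc.trans (splittingBound_mono (Nat.le_succ _)), ?_⟩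
    rintro ψ (rfl | hψ)
    · exact (hs _ φ.self_mem_subformulas).neg
    · exact hs ψ hψ
  | know φ ih =>
    obtain ⟨F₀, hfin₀, hFo₀, hF₀, hFc₀, hs₀⟩ := ih
    obtain ⟨F, hSF, hfin, hFo, hF, hFc⟩ := extend
      (F₀ ∪ (fun U => interior {x ∈ U | M.Sat φ x U}) '' F₀) φ.complexity
      (hfin₀.union (hfin₀.image _))
      (by
        rintro U (hU | ⟨_, _, rfl⟩)
        · exact (hM U).1 (hFo₀ hU)
        · exact isOpen_interior)
      (by
        have h₁ := ncard_union_le F₀ ((fun U => interior {x ∈ U | M.Sat φ x U}) '' F₀)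
        have h₂ := ncard_image_le (f := fun U => interior {x ∈ U | M.Sat φ x U}) hfin₀
        omega)
    have hFF := subset_union_left.trans hSF
    refine ⟨F, hfin, hFo, hF, hFc, ?_⟩
    rintro ψ (rfl | hψ)
    · exact (hs₀ _ φ.self_mem_subformulas).know hM hfin₀ hF₀ hFo₀ hFF
        fun U hU => hSF (.inr ⟨U, hU, rfl⟩)
    · exact (hs₀ ψ hψ).mono hFF
  | box φ ih =>
    obtain ⟨F₀, hfin₀, hFo₀, hF₀, hFc₀, hs₀⟩ := ih
    obtain ⟨F, hSF, hfin, hFo, hF, hFc⟩ := extend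
      (F₀ ∪ (fun p : Set X × Set X => interior (p.1ᶜ ∪ p.2)) '' F₀ ×ˢ F₀) φ.complexity
      (hfin₀.union ((hfin₀.prod hfin₀).image _))
      (by
        rintro U (hU | ⟨_, _, rfl⟩)
        · exact (hM U).1 (hFo₀ hU)
        · exact isOpen_interior)
      (by
        have h₁ := ncard_union_le F₀
          ((fun p : Set X × Set X => interior (p.1ᶜ ∪ p.2)) '' F₀ ×ˢ F₀)
        have h₂ := ncard_image_le (f := fun p : Set X × Set X => interior (p.1ᶜ ∪ p.2))
          (hfin₀.prod hfin₀)
        have h₃ := Nat.mul_le_mul hFc₀ hFc₀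
        rw [ncard_prod] at h₂
        omega)
    have hFF := subset_union_left.trans hSF
    refine ⟨F, hfin, hFo, hF, hFc, ?_⟩
    rintro ψ (rfl | hψ)
    · exact (hs₀ _ φ.self_mem_subformulas).box hM hfin₀ hF₀ hFo₀
        fun U hU W hW => hSF (.inr ⟨(U, W), ⟨hU, hW⟩, rfl⟩)
    · exact (hs₀ ψ hψ).mono hFF

end Topological

/-! ### Stability of remainders and the quotient model. -/

theorem subset_iff_of_mem_remainder {U V : Set X} (hV : V ∈ M.remainder F U) :
    ∀ W ∈ F, V ⊆ W ↔ U ⊆ W :=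
  fun W hW => ⟨fun h => by_contra fun hUW => hV.2.2 W hW hUW h, hV.2.1.trans⟩

theorem Separates.sat_iff (h : M.Separates F φ) {U V : Set X} (hU : U ∈ M.opens)
    (hV : V ∈ M.remainder F U) {x : X} (hx : x ∈ V) : M.Sat φ x V ↔ M.Sat φ x U :=
  h V hV.1 U hU (subset_iff_of_mem_remainder hV) x hx (hV.2.1 hx)

theorem Separates.isStable (h : M.Separates F φ) {U : Set X} (hU : U ∈ M.opens) :
    M.IsStable (M.remainder F U) φ := by
  intro x
  by_cases hx : M.Sat φ x U
  · exact .inl fun V hV hxV => (h.sat_iff hU hV hxV).2 hx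
  · exact .inr fun V hV hxV hsat => hx ((h.sat_iff hU hV hxV).1 hsat)

/-- Members of `F` are saturated for indistinguishability. -/
theorem cls_mem_image_iff {U : Set X} (hU : U ∈ F) {x : X} :
    M.cls F φ x ∈ M.cls F φ '' U ↔ x ∈ U := by
  refine ⟨?_, fun h => ⟨x, h, rfl⟩⟩
  rintro ⟨y, hy, hyx⟩
  exact ((Quotient.exact hyx).1 U hU).1 hy

theorem cls_mem_image_val_iff {a : α} (ha : a ∈ φ.atoms) {x : X} :
    M.cls F φ x ∈ M.cls F φ '' M.val a ↔ x ∈ M.val a := by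
  refine ⟨?_, fun h => ⟨x, h, rfl⟩⟩
  rintro ⟨y, hy, hyx⟩
  exact ((Quotient.exact hyx).2 a ha).1 hy

theorem cls_image_subset_iff {U V : Set X} (hV : V ∈ F) :
    M.cls F φ '' U ⊆ M.cls F φ '' V ↔ U ⊆ V :=
  ⟨fun h _ hx => (cls_mem_image_iff hV).1 (h ⟨_, hx, rfl⟩), image_mono⟩

theorem mem_quotient_opens_iff (hF : univ ∈ F) {W : Set (M.QuotPoint F φ)} :
    W ∈ (M.quotient F hF φ).opens ↔ M.cls F φ ⁻¹' W ∈ F := by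
  constructor
  · rintro ⟨U, hU, rfl⟩
    have : M.cls F φ ⁻¹' (M.cls F φ '' U) = U := by
      ext x
      exact cls_mem_image_iff hU
    rwa [this]
  · exact fun h => ⟨_, h, (image_preimage_eq W Quotient.mk_surjective).symm⟩

/-- Taking preimages identifies the quotient's opens with `F`, where arbitrary unions reduce to
finite ones. -/
theorem isTopological_quotient (hfin : F.Finite) (hF : IsSetLattice F) :
    (M.quotient F hF.univ_mem φ).IsTopological := by
  refine ⟨{ IsOpen := fun W => M.cls F φ ⁻¹' W ∈ F
            isOpen_univ := hF.univ_mem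
            isOpen_inter := fun U V hU hV => hF.inter_mem _ hU _ hV
            isOpen_sUnion := fun S hS => ?_ }, fun W => mem_quotient_opens_iff hF.univ_mem⟩
  have : M.cls F φ ⁻¹' ⋃₀ S = ⋃₀ (preimage (M.cls F φ) '' S) := by
    rw [sUnion_image, preimage_sUnion]
  rw [this]
  exact hF.sUnion_mem hfin (image_subset_iff.2 hS)

theorem sat_quotient_iff (hfin : F.Finite) (hopen : F ⊆ M.opens) (hF : IsSetLattice F)
    (ψ : Formula α) (hψ : ψ.atoms ⊆ φ.atoms)
    (hsub : ∀ χ ∈ ψ.subformulas, M.Separates F χ) {U : Set X} (hU : U ∈ F) {x : X} (hx : x ∈ U) :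
    M.Sat ψ x U ↔ (M.quotient F hF.univ_mem φ).Sat ψ (M.cls F φ x) (M.cls F φ '' U) := by
  induction ψ generalizing U x with
  | atom a => exact (cls_mem_image_val_iff (hψ rfl)).symm
  | top => rfl
  | bot => rfl
  | and ψ₁ ψ₂ ih₁ ih₂ =>
    exact and_congr
      (ih₁ (subset_union_left.trans hψ) (fun χ h => hsub χ (.inr (.inl h))) hU hx)
      (ih₂ (subset_union_right.trans hψ) (fun χ h => hsub χ (.inr (.inr h))) hU hx)
  | neg ψ ih => exact not_congr (ih hψ (fun χ h => hsub χ (.inr h)) hU hx)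
  | know ψ ih =>
    have ih' := fun {y} => ih hψ (fun χ h => hsub χ (.inr h)) hU (x := y)
    constructor
    · rintro h _ ⟨y, hy, rfl⟩
      exact (ih' hy).1 (h y hy)
    · exact fun h y hy => (ih' hy).2 (h _ ⟨y, hy, rfl⟩)
  | box ψ ih =>
    have ih' := fun {V} (hV : V ∈ F) {y} => ih hψ (fun χ h => hsub χ (.inr h)) hV (x := y)
    constructor
    · rintro h _ ⟨V, hV, rfl⟩ hVU hxV
      rw [cls_mem_image_iff hV] at hxV
      exact (ih' hV hxV).1 (h V (hopen hV) ((cls_image_subset_iff hU).1 hVU) hxV)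
    -- An arbitrary open `V ⊆ U` need not be in `F`; its hull `W` is, stays inside `U`, and agrees
    -- with `V` on `ψ` by separation.
    · intro h V hV hVU hxV
      obtain ⟨W, hW, hVW, hmin⟩ := hF.exists_hull hfin V
      have hWU := hmin U hU hVU
      have hsat := (ih' hW (hVW hxV)).2
        (h _ ⟨W, hW, rfl⟩ (image_mono hWU) ⟨x, hVW hxV, rfl⟩)
      exact (hsub ψ (.inr ψ.self_mem_subformulas) V hV W (hopen hW)
        (fun Z hZ => ⟨hmin Z hZ, hVW.trans⟩) x hxV (hVW hxV)).2 hsat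

theorem finite_quotPoint_and_card_le (M : Model α X) (hfin : F.Finite) (φ : Formula α) :
    Finite (M.QuotPoint F φ) ∧
      Nat.card (M.QuotPoint F φ) ≤ 2 ^ F.ncard * 2 ^ φ.atoms.ncard := by
  have := hfin.to_subtype
  have := φ.finite_atoms.to_subtype
  -- A class is determined by the members of `F` and the atoms' interpretations containing it.
  let g : M.QuotPoint F φ → Set F × Set φ.atoms := fun q =>
    ({U | q ∈ M.cls F φ '' U.1}, {a | q ∈ M.cls F φ '' M.val a.1})
  have hg : Function.Injective g := by
    intro p q
    induction p using Quotient.inductionOn with | _ x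
    induction q using Quotient.inductionOn with | _ y
    intro h
    obtain ⟨h₁, h₂⟩ := Prod.ext_iff.1 h
    refine Quotient.sound ⟨fun U hU => ?_, fun a ha => ?_⟩
    · exact (cls_mem_image_iff hU).symm.trans
        ((Set.ext_iff.1 h₁ ⟨U, hU⟩).trans (cls_mem_image_iff hU))
    · exact (cls_mem_image_val_iff ha).symm.trans
        ((Set.ext_iff.1 h₂ ⟨a, ha⟩).trans (cls_mem_image_val_iff ha))
  refine ⟨Finite.of_injective g hg, (Nat.card_le_card_of_injective g hg).trans_eq ?_⟩
  have := Fintype.ofFinite F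
  have := Fintype.ofFinite φ.atoms
  rw [Nat.card_prod, ← Nat.card_coe_set_eq, ← Nat.card_coe_set_eq]
  simp only [Nat.card_eq_fintype_card, Fintype.card_set]

end Model

end TopoLogic

theorem mainTheorem3 :
    ∃ f : ℕ → ℕ, Computable f ∧
      ∀ (α : Type*) (X : Type*) (M : TopoLogic.Model α X) (φ : TopoLogic.Formula α),
        M.IsTopological → M.Satisfies φ →
        ∃ (F : Set (Set X)) (hF : Set.univ ∈ F),
          (∀ ψ ∈ φ.subformulas, M.IsStableSplitting F ψ) ∧
          (M.quotient F hF φ).IsTopological ∧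
          Finite (M.QuotPoint F φ) ∧
          F.ncard ≤ f φ.complexity ∧
          (M.quotient F hF φ).opens.ncard ≤ f φ.complexity ∧
          Nat.card (M.QuotPoint F φ) ≤ f φ.complexity ∧
          (∀ ψ ∈ φ.subformulas, ∀ U ∈ F, ∀ V ∈ M.remainder F U, ∀ x ∈ V,
            M.Sat ψ x V ↔ (M.quotient F hF φ).Sat ψ (M.cls F φ x) (M.cls F φ '' U)) ∧
          (M.quotient F hF φ).Satisfies φ := by
  refine ⟨TopoLogic.modelBound, TopoLogic.computable_modelBound, ?_⟩
  rintro α X M φ ⟨t, hM⟩ ⟨V, hV, x, hx, hsat⟩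
  obtain ⟨F, hfin, hopen, hF, hcard, hs⟩ := TopoLogic.Model.exists_separates hM φ
  obtain ⟨hpts, hptsc⟩ := M.finite_quotPoint_and_card_le hfin φ
  have hbound := hcard.trans (TopoLogic.splittingBound_le_modelBound _)
  have truth : ∀ ψ ∈ φ.subformulas, ∀ U ∈ F, ∀ V ∈ M.remainder F U, ∀ x ∈ V,
      M.Sat ψ x V ↔
        (M.quotient F hF.univ_mem φ).Sat ψ (M.cls F φ x) (M.cls F φ '' U) :=
    fun ψ hψ U hU V hV x hx => ((hs ψ hψ).sat_iff (hopen hU) hV hx).trans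
      (TopoLogic.Model.sat_quotient_iff hfin hopen hF ψ
        (TopoLogic.Formula.atoms_subset_of_mem_subformulas hψ)
        (fun χ hχ => hs χ (TopoLogic.Formula.subformulas_subset hψ hχ)) hU (hV.2.1 hx))
  refine ⟨F, hF.univ_mem,
    fun ψ hψ => ⟨⟨hfin, hopen, hF.inter_mem⟩, fun U hU => (hs ψ hψ).isStable (hopen hU)⟩,
    TopoLogic.Model.isTopological_quotient hfin hF, hpts, hbound, ?_, ?_, truth, ?_⟩
  · have : (M.quotient F hF.univ_mem φ).opens = (fun U => M.cls F φ '' U) '' F := by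
      ext W
      exact ⟨fun ⟨U, hU, h⟩ => ⟨U, hU, h.symm⟩, fun ⟨U, hU, h⟩ => ⟨U, hU, h.symm⟩⟩
    rw [this]
    exact (Set.ncard_image_le hfin).trans hbound
  · refine hptsc.trans (Nat.mul_le_mul ?_ ?_)
    · exact Nat.pow_le_pow_right (by norm_num) hcard
    · exact Nat.pow_le_pow_right (by norm_num) φ.ncard_atoms_le
  -- The witness `V` lies in the remainder of its hull `U`, so `φ` holds at the image of `U`.
  · obtain ⟨U, hU, hVU, hmin⟩ := hF.exists_hull hfin V
    exact ⟨_, ⟨U, hU, rfl⟩, _, ⟨x, hVU hx, rfl⟩, (truth φ φ.self_mem_subformulas U hU V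
      ⟨hV, hVU, fun W hW hUW hVW => hUW (hmin W hW hVW)⟩ x hx).1 hsat⟩
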